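/- Let $R$ be a commutative noetherian ring. For an $R$-complex $X$ (a $\mathbb{Z}$-indexed complex of $R$-modules) put $\inf X=\inf\{n\in\mathbb{Z}\mid \mathrm{H}_n(X)\neq 0\}$ and $\sup X=\sup\{n\in\mathbb{Z}\mid \mathrm{H}_n(X)\neq 0\}$ in $\mathbb{Z}\cup\{\pm\infty\}$, with $\inf\emptyset=+\infty$ and $\sup\emptyset=-\infty$. Write $X\simeq 0$ if $X$ is acyclic, and write $E_R(N)$ for the injective envelope of an $R$-module $N$. If $(A,\mathfrak{n},k)$ is a commutative local ring and $X$ is an $A$-complex, put $$\mathrm{depth}_A X=-\sup \mathrm{RHom}_A(k,X),\qquad \mathrm{width}_A X=\inf (k\otimes^{\mathrm{L}}_A X).$$ For a prime ideal $\mathfrak{p}$ of $R$ let $k(\mathfrak{p})=R_\mathfrak{p}/\mathfrak{p}R_\mathfrak{p}$. For an $R$-complex $M$ define the Matlis dual and the co-localization at $\mathfrak{p}$ by $$D_R(M)=\mathrm{Hom}_R\Big(M,\bigoplus_{\mathfrak{m}\in\mathrm{Max}R}E_R(R/\mathfrak{m})\Big),\qquad {}^{\mathfrak{p}}M=\mathrm{Hom}_{R_\mathfrak{p}}\big(D_R(M)_\mathfrak{p},E_{R_\mathfrak{p}}(k(\mathfrak{p}))\big).$$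 Let $\mathrm{Ass}_R X$ be the set of associated primes of $X$ in Christensen's sense, i.e. of the primes $\mathfrak{p}$ with $\mathrm{depth}_{R_\mathfrak{p}}X_\mathfrak{p}=-\sup X_\mathfrak{p}<\infty$. Let $\mathrm{Coass}_R M$ be the set of coassociated primes of $M$, i.e. of the primes $\mathfrak{p}$ with ${}^{\mathfrak{p}}M\not\simeq 0$ and $\mathrm{width}_{R_\mathfrak{p}}{}^{\mathfrak{p}}M=\inf{}^{\mathfrak{p}}M>-\infty$. **Theorem.** Let $M$ be an $R$-complex that is bounded below, i.e. $\mathrm{H}_n(M)=0$ for all $n\ll 0$. Then for every prime ideal $\mathfrak{p}$ of $R$, $$\mathfrak{p}\in\mathrm{Coass}_R M\iff \mathfrak{p}\in\mathrm{Ass}_R D_R(M).$$ In particular, $M\not\simeq 0$ if and only if $\mathrm{Coass}_R M\neq\emptyset$. -/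

import Mathlib

open CategoryTheory

universe u

namespace CoassPrimes

/-! ### Injective envelopes -/

section InjectiveEnvelope

variable {R : Type u} [CommRing R]

/-- `f : N → E` is an injective envelope: `E` is injective, `f` is injective, and `E` is an
essential extension of the image of `f`. -/
structure IsInjectiveEnvelope {N E : Type u} [AddCommGroup N] [Module R N] [AddCommGroup E]
    [Module R E] (f : N →ₗ[R] E) : Prop where
  injective_module : Module.Injective R E
  injective : Function.Injective f
  essential : ∀ S : Submodule R E, S ⊓ LinearMap.range f = ⊥ → S = ⊥

theorem exists_injective_embedding (N : Type u) [AddCommGroup N] [Module R N] :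
    ∃ (I : ModuleCat.{u} R) (f : N →ₗ[R] I), Module.Injective R I ∧ Function.Injective f := by
  refine ⟨Injective.under (ModuleCat.of R N), (Injective.ι (ModuleCat.of R N)).hom, ?_, ?_⟩
  · exact (Module.injective_iff_injective_object R _).mpr (Injective.injective_under _)
  · exact (ModuleCat.mono_iff_injective _).mp inferInstance

theorem sSup_inf_eq_bot {I : Type u} [AddCommGroup I] [Module R I] (N S : Submodule R I)
    (c : Set (Submodule R I)) (hc : IsChain (· ≤ ·) c) (hne : c.Nonempty) (hS : S ≤ sSup c)
    (h : ∀ F ∈ c, ∀ T ≤ F, T ≤ S → T ⊓ N = ⊥ → T = ⊥) (hSN : S ⊓ N = ⊥) : S = ⊥ := by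
  rw [Submodule.eq_bot_iff]
  intro x hx
  obtain ⟨F, hF, hxF⟩ := (Submodule.mem_sSup_of_directed hne hc.directedOn).mp (hS hx)
  have h1 : Submodule.span R {x} ≤ S := by simpa using hx
  have h2 := h F hF (Submodule.span R {x}) (by simpa using hxF) h1
    (le_bot_iff.mp (hSN ▸ inf_le_inf_right N h1))
  simpa using h2

theorem exists_isInjectiveEnvelope (N : Type u) [AddCommGroup N] [Module R N] :
    ∃ (E : ModuleCat.{u} R) (f : N →ₗ[R] E), IsInjectiveEnvelope f := by
  obtain ⟨I, ι, hI, hι⟩ := exists_injective_embedding (R := R) N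
  let N₀ := LinearMap.range ι
  -- a maximal essential extension `E` of `N₀` inside `I`
  obtain ⟨E, hNE, ⟨-, hEess⟩, hEmax⟩ := zorn_le_nonempty₀
    {F : Submodule R I | N₀ ≤ F ∧ ∀ S ≤ F, S ⊓ N₀ = ⊥ → S = ⊥}
    (fun c hcs hc y hy => ⟨sSup c,
      ⟨(hcs hy).1.trans (le_sSup hy), fun S hS hSN => sSup_inf_eq_bot N₀ S c hc ⟨y, hy⟩ hS
        (fun F hF T hT _ hTN => (hcs hF).2 T hT hTN) hSN⟩,
      fun z hz => le_sSup hz⟩) N₀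
    ⟨le_rfl, fun S hS h => by rwa [inf_eq_left.mpr hS] at h⟩
  -- a maximal submodule `C` of `I` that meets `E` trivially
  obtain ⟨C, -, hCE, hCmax⟩ := zorn_le_nonempty₀
    {C : Submodule R I | C ⊓ E = ⊥}
    (fun c hcs hc y hy => ⟨sSup c, by
      refine sSup_inf_eq_bot ⊤ _ c hc ⟨y, hy⟩ inf_le_left (fun F hF T hT hTS _ => ?_) ?_
      · exact le_bot_iff.mp ((hcs hF) ▸ le_inf hT (hTS.trans inf_le_right))
      · rw [inf_top_eq, Submodule.eq_bot_iff]
        rintro x ⟨hx, hxE⟩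
        obtain ⟨F, hF, hxF⟩ := (Submodule.mem_sSup_of_directed ⟨y, hy⟩ hc.directedOn).mp hx
        have : x ∈ F ⊓ E := ⟨hxF, hxE⟩
        rwa [hcs hF] at this, fun z hz => le_sSup hz⟩) ⊥ (by simp)
  have hCE' : C ⊓ E = ⊥ := hCE
  have hCm : ∀ T : Submodule R I, C ≤ T → T ⊓ E = ⊥ → T = C :=
    fun T hT h => le_antisymm (hCmax h hT) hT
  have hg : Function.Injective (C.mkQ ∘ₗ E.subtype) := by
    rw [← LinearMap.ker_eq_bot, Submodule.eq_bot_iff]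
    intro x hx
    have h1 : (x : I) ∈ C := by simpa using hx
    have h2 : (x : I) ∈ C ⊓ E := ⟨h1, x.2⟩
    rw [hCE'] at h2
    exact Subtype.ext h2
  obtain ⟨h, hh⟩ := hI.out (C.mkQ ∘ₗ E.subtype) hg E.subtype
  let r : I →ₗ[R] I := h ∘ₗ C.mkQ
  have hr : ∀ x ∈ E, r x = x := fun x hx => hh ⟨x, hx⟩
  have hrC : ∀ x ∈ C, r x = 0 := fun x hx => by
    have : C.mkQ x = 0 := by simpa using hx
    simp [r, this]
  have hE_le : E ≤ LinearMap.range r := fun x hx => ⟨x, hr x hx⟩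
  have hrange : LinearMap.range r = E := by
    refine le_antisymm (hEmax ⟨hNE.trans hE_le, fun S hS hSN => ?_⟩ hE_le) hE_le
    have hSE : S ⊓ E = ⊥ := hEess _ inf_le_right
      (le_bot_iff.mp (hSN ▸ inf_le_inf_right N₀ inf_le_left))
    have hT : S.comap r = C := by
      refine hCm _ (fun x hx => ?_) ?_
      · simp [Submodule.mem_comap, hrC x hx]
      · rw [Submodule.eq_bot_iff]
        rintro x ⟨hx, hxE⟩
        have h1 : r x ∈ S := hx
        rw [hr x hxE] at h1
        have h2 : x ∈ S ⊓ E := ⟨h1, hxE⟩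
        rwa [hSE] at h2
    rw [Submodule.eq_bot_iff]
    intro s hs
    obtain ⟨t, rfl⟩ := hS hs
    exact hrC t (hT ▸ (show t ∈ S.comap r from hs))
  let q : I →ₗ[R] E := r.codRestrict E (fun x => hrange ▸ LinearMap.mem_range_self r x)
  have hι_mem : ∀ x, ι x ∈ E := fun x => hNE (LinearMap.mem_range_self ι x)
  refine ⟨ModuleCat.of R E, ι.codRestrict E hι_mem, ⟨⟨?_⟩, ?_, ?_⟩⟩
  · intro X Y _ _ _ _ f hf g
    let g' : X →ₗ[R] E := g
    obtain ⟨k, hk⟩ := hI.out f hf (E.subtype ∘ₗ g')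
    refine ⟨q ∘ₗ k, fun x => Subtype.ext ?_⟩
    change r (k (f x)) = (g' x : I)
    rw [hk]
    exact hr _ (g' x).2
  · intro x y hxy
    exact hι (congrArg Subtype.val hxy)
  · intro S hS
    let S' : Submodule R E := S
    have h1 : S'.map E.subtype = ⊥ := by
      refine hEess _ (Submodule.map_subtype_le E S') ?_
      rw [Submodule.eq_bot_iff]
      rintro _ ⟨⟨x, hx, rfl⟩, ⟨n, hn⟩⟩
      have h2 : x ∈ S ⊓ LinearMap.range (ι.codRestrict E hι_mem) :=
        ⟨hx, ⟨n, Subtype.ext hn⟩⟩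
      rw [hS] at h2
      have h3 : x = 0 := h2
      simp [h3]
    exact Submodule.map_injective_of_injective E.injective_subtype (by
      rw [h1, Submodule.map_bot])

/-- The injective envelope `E_R(N)` of an `R`-module `N`. -/
noncomputable def injectiveEnvelope (R : Type u) [CommRing R] (N : Type u) [AddCommGroup N]
    [Module R N] : ModuleCat.{u} R :=
  (exists_isInjectiveEnvelope (R := R) N).choose

/-- The structure map `N → E_R(N)`. -/
noncomputable def injectiveEnvelopeMap (R : Type u) [CommRing R] (N : Type u) [AddCommGroup N]
    [Module R N] : N →ₗ[R] injectiveEnvelope R N :=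
  (exists_isInjectiveEnvelope (R := R) N).choose_spec.choose

theorem isInjectiveEnvelope_injectiveEnvelopeMap (N : Type u) [AddCommGroup N] [Module R N] :
    IsInjectiveEnvelope (injectiveEnvelopeMap R N) :=
  (exists_isInjectiveEnvelope (R := R) N).choose_spec.choose_spec

end InjectiveEnvelope

/-! ### Complexes

An `R`-complex is a `ℤ`-indexed complex of `R`-modules. It is written cohomologically, with the
usual dictionary `M_n = M^{-n}`; in particular the homology module `H_n(M)` is `H^{-n}(M)`. -/

section Complexes

/-- `inf M = inf {n | H_n(M) ≠ 0}`, an element of `ℤ ∪ {±∞}` (it is `+∞` for acyclic `M`). -/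
noncomputable def hinf {A : Type*} [Category A] [Abelian A] (M : CochainComplex A ℤ) : EReal :=
  sInf ((fun n : ℤ => ((n : ℝ) : EReal)) '' {n : ℤ | ¬ Limits.IsZero (M.homology (-n))})

/-- `sup M = sup {n | H_n(M) ≠ 0}`, an element of `ℤ ∪ {±∞}` (it is `-∞` for acyclic `M`). -/
noncomputable def hsup {A : Type*} [Category A] [Abelian A] (M : CochainComplex A ℤ) : EReal :=
  sSup ((fun n : ℤ => ((n : ℝ) : EReal)) '' {n : ℤ | ¬ Limits.IsZero (M.homology (-n))})

/-- `M` is (homologically) bounded below: `H_n(M) = 0` for all `n ≪ 0`. -/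
def IsBoundedBelow {A : Type*} [Category A] [Abelian A] (M : CochainComplex A ℤ) : Prop :=
  ∃ N : ℤ, ∀ n < N, Limits.IsZero (M.homology (-n))

variable {R : Type u} [CommRing R]

/-- The complex `Hom_R(M, E)`, for a complex `M` and a module `E` (a complex in degree `0`), with
the sign convention `dψ = -(-1)^{|ψ|} ψ ∘ d` of Hom complexes. -/
noncomputable def homInto (M : CochainComplex (ModuleCat.{u} R) ℤ) (E : ModuleCat.{u} R) :
    CochainComplex (ModuleCat.{u} R) ℤ where
  X n := ModuleCat.of R (M.X (-n) →ₗ[R] E)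
  d i j := (i + 1).negOnePow • ModuleCat.ofHom (LinearMap.lcomp R E (M.d (-j) (-i)).hom)
  shape i j hij := by
    have h : M.d (-j) (-i) = 0 := M.shape _ _ (by
      simp only [ComplexShape.up_Rel] at hij ⊢
      lia)
    rw [h]
    have h' : ModuleCat.ofHom (LinearMap.lcomp R E (0 : M.X (-j) ⟶ M.X (-i)).hom) = 0 := by
      refine ModuleCat.hom_ext (LinearMap.ext fun (f : M.X (-i) →ₗ[R] E) =>
        LinearMap.ext fun x => ?_)
      exact map_zero f
    rw [h', smul_zero]
  d_comp_d' i j k _ _ := by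
    have h : ModuleCat.ofHom (LinearMap.lcomp R E (M.d (-j) (-i)).hom) ≫
        ModuleCat.ofHom (LinearMap.lcomp R E (M.d (-k) (-j)).hom) = 0 := by
      refine ModuleCat.hom_ext (LinearMap.ext fun (f : M.X (-i) →ₗ[R] E) =>
        LinearMap.ext fun x => ?_)
      have h0 : (M.d (-j) (-i)).hom ((M.d (-k) (-j)).hom x) = 0 := by
        rw [← ModuleCat.comp_apply, M.d_comp_d]
        rfl
      change f ((M.d (-j) (-i)).hom ((M.d (-k) (-j)).hom x)) = 0
      rw [h0, map_zero]
    rw [Linear.units_smul_comp, Linear.comp_units_smul, h, smul_zero, smul_zero]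

/-- The module `⨁_{𝔪 ∈ Max R} E(R/𝔪)`. -/
noncomputable def maxEnvelope (R : Type u) [CommRing R] : ModuleCat.{u} R :=
  ModuleCat.of R
    (DirectSum (MaximalSpectrum R) fun 𝔪 => injectiveEnvelope R (R ⧸ 𝔪.asIdeal))

/-- The Matlis dual `D_R(M) = Hom_R(M, ⨁_{𝔪 ∈ Max R} E(R/𝔪))` of an `R`-complex `M`. -/
noncomputable def matlisDual (M : CochainComplex (ModuleCat.{u} R) ℤ) :
    CochainComplex (ModuleCat.{u} R) ℤ :=
  homInto M (maxEnvelope R)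

/-- The localization `M_𝔭`, a complex of `R_𝔭`-modules. -/
noncomputable def localizationAt (𝔭 : PrimeSpectrum R) (M : CochainComplex (ModuleCat.{u} R) ℤ) :
    CochainComplex (ModuleCat.{u} (Localization.AtPrime 𝔭.asIdeal)) ℤ :=
  ((ModuleCat.localizedModuleFunctor 𝔭.asIdeal.primeCompl).mapHomologicalComplex _).obj M

/-- The co-localization `^𝔭M = Hom_{R_𝔭}(D_R(M)_𝔭, E_{R_𝔭}(k(𝔭)))`, a complex of
`R_𝔭`-modules. -/
noncomputable def colocalizationAt (𝔭 : PrimeSpectrum R)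
    (M : CochainComplex (ModuleCat.{u} R) ℤ) :
    CochainComplex (ModuleCat.{u} (Localization.AtPrime 𝔭.asIdeal)) ℤ :=
  homInto (localizationAt 𝔭 (matlisDual M))
    (injectiveEnvelope (Localization.AtPrime 𝔭.asIdeal) 𝔭.asIdeal.ResidueField)

/-! ### Depth and width over a local ring -/

/-- A projective resolution of the residue field of a local ring, as a complex. -/
noncomputable def residueFieldResolution (A : Type u) [CommRing A] [IsLocalRing A] :
    CochainComplex (ModuleCat.{u} A) ℤ :=
  (ProjectiveResolution.of (ModuleCat.of A (IsLocalRing.ResidueField A))).cochainComplex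

/-- `RHom_A(k, M)`, computed by a projective resolution of `k`, as a complex of abelian groups. -/
noncomputable def RHomResidueField {A : Type u} [CommRing A] [IsLocalRing A]
    (M : CochainComplex (ModuleCat.{u} A) ℤ) : CochainComplex AddCommGrpCat.{u} ℤ :=
  CochainComplex.HomComplex (residueFieldResolution A) M

/-- `k ⊗ᴸ_A M`, computed by a projective resolution of `k`. -/
noncomputable def residueFieldTensorL {A : Type u} [CommRing A] [IsLocalRing A]
    (M : CochainComplex (ModuleCat.{u} A) ℤ) : CochainComplex (ModuleCat.{u} A) ℤ :=
  HomologicalComplex.tensorObj (residueFieldResolution A) M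

/-- `depth_A M = - sup RHom_A(k, M)`. -/
noncomputable def depth {A : Type u} [CommRing A] [IsLocalRing A]
    (M : CochainComplex (ModuleCat.{u} A) ℤ) : EReal :=
  - hsup (RHomResidueField M)

/-- `width_A M = inf (k ⊗ᴸ_A M)`. -/
noncomputable def width {A : Type u} [CommRing A] [IsLocalRing A]
    (M : CochainComplex (ModuleCat.{u} A) ℤ) : EReal :=
  hinf (residueFieldTensorL M)

/-! ### Associated and coassociated primes of complexes -/

/-- The associated primes of a complex in Christensen's sense: the primes `𝔭` with
`depth_{R_𝔭} M_𝔭 = - sup M_𝔭 < ∞`. -/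
def Ass (M : CochainComplex (ModuleCat.{u} R) ℤ) : Set (PrimeSpectrum R) :=
  {𝔭 | depth (localizationAt 𝔭 M) = - hsup (localizationAt 𝔭 M) ∧
    - hsup (localizationAt 𝔭 M) < ⊤}

/-- The big cosupport: the primes `𝔭` such that `^𝔭M` is not acyclic. -/
def coSupp (M : CochainComplex (ModuleCat.{u} R) ℤ) : Set (PrimeSpectrum R) :=
  {𝔭 | ¬ (colocalizationAt 𝔭 M).Acyclic}

/-- The coassociated primes of a complex: the primes `𝔭` in the big cosupport with
`width_{R_𝔭} ^𝔭M = inf ^𝔭M > -∞`. -/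
def Coass (M : CochainComplex (ModuleCat.{u} R) ℤ) : Set (PrimeSpectrum R) :=
  {𝔭 | 𝔭 ∈ coSupp M ∧ width (colocalizationAt 𝔭 M) = hinf (colocalizationAt 𝔭 M) ∧
    ⊥ < hinf (colocalizationAt 𝔭 M)}

end Complexes

end CoassPrimes

/-! Fix `𝔭`, put `A = R_𝔭`, `E = E_A(k(𝔭))` and `X = D_R(M)_𝔭`, so that `^𝔭M = Hom_A(X, E)`. Duality
into an injective cogenerator is exact and detects zero, so boundedness below of `M` makes `X`
bounded above, and `sup X = s` forces `inf ^𝔭M = -s`. Both conditions can then be read off one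
homology module.

On the Ass side, `k` has a resolution in nonnegative homological degrees, so `H_s(RHom(k, X)) =
Hom(k, H_s(X))` and higher homology vanishes: depth equals `-s` iff `Hom(k, H_s(X)) ≠ 0`
(`depth_eq_iff`). On the Coass side, tensor-hom adjunction turns the dual of `k ⊗ᴸ Y` into `RHom(k,
Hom(Y, E))`; for `Y = Hom(X, E)` the width condition becomes `Hom(k, H_s(X)**) ≠ 0`, where `*` is
`Hom(-, E)` (`width_eq_iff`).

What remains is pure module theory: over a noetherian local ring a module has zero socle iff its
double dual does (`subsingleton_residueField_hom_dual_dual_iff`).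

For the last assertion, if `M` is not acyclic then neither is `D_R(M)`, and an associated prime of
its top homology module lies in `Ass`. -/

namespace CoassPrimes

/-! ### Injective cogenerators -/

section Cogenerator

/-- An injective cogenerator: an injective module `E` such that every nonzero element of every
module is detected by a linear map to `E`. -/
structure IsInjectiveCogenerator (R : Type u) [CommRing R] (E : Type u) [AddCommGroup E]
    [Module R E] : Prop where
  injective : Module.Injective R E
  exists_apply_ne_zero : ∀ (N : Type u) [AddCommGroup N] [Module R N] (x : N), x ≠ 0 →
    ∃ f : N →ₗ[R] E, f x ≠ 0

variable {R : Type u} [CommRing R]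

theorem exists_extension {E : Type u} [AddCommGroup E] [Module R E] (hE : Module.Injective R E)
    {N L : Type u} [AddCommGroup N] [Module R N] [AddCommGroup L] [Module R L]
    (i : N →ₗ[R] L) (hi : Function.Injective i) (g : N →ₗ[R] E) : ∃ h : L →ₗ[R] E, h ∘ₗ i = g := by
  obtain ⟨h, hh⟩ := hE.out i hi g
  exact ⟨h, LinearMap.ext hh⟩

/-- For `x ≠ 0` the cyclic module `Rx ≅ R/ann x` maps onto some `R/𝔪`; the given map to `E` then
extends from `Rx` to all of `N`. -/
theorem IsInjectiveCogenerator.of_isMaximal {E : Type u} [AddCommGroup E] [Module R E]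
    (hE : Module.Injective R E)
    (h : ∀ 𝔪 : Ideal R, 𝔪.IsMaximal → ∃ f : (R ⧸ 𝔪) →ₗ[R] E, f 1 ≠ 0) :
    IsInjectiveCogenerator R E := by
  refine ⟨hE, fun N _ _ x hx => ?_⟩
  have hne : LinearMap.ker (LinearMap.toSpanSingleton R N x) ≠ ⊤ := by
    intro htop
    have : (1 : R) ∈ LinearMap.ker (LinearMap.toSpanSingleton R N x) := htop ▸ trivial
    simp at this
    exact hx this
  obtain ⟨𝔪, h𝔪, hle⟩ := Ideal.exists_le_maximal _ hne
  obtain ⟨f, hf⟩ := h 𝔪 h𝔪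
  let q : (R ⧸ LinearMap.ker (LinearMap.toSpanSingleton R N x)) →ₗ[R] E :=
    f ∘ₗ Submodule.mapQ _ 𝔪 LinearMap.id hle
  let i : (R ⧸ LinearMap.ker (LinearMap.toSpanSingleton R N x)) →ₗ[R] N :=
    Submodule.liftQ _ (LinearMap.toSpanSingleton R N x) le_rfl
  have hi : Function.Injective i := by
    rw [← LinearMap.ker_eq_bot]
    exact Submodule.ker_liftQ_eq_bot _ _ _ le_rfl
  obtain ⟨g, hg⟩ := exists_extension hE i hi q
  refine ⟨g, fun h0 => hf ?_⟩
  have h1 := LinearMap.congr_fun hg (Submodule.Quotient.mk 1)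
  have h2 : i (Submodule.Quotient.mk 1) = x :=
    (Submodule.liftQ_apply _ _ _).trans (one_smul R x)
  rw [LinearMap.comp_apply, h2, h0] at h1
  exact h1.symm

/-- Baer's criterion: a map from a finitely generated ideal meets only finitely many summands, so
componentwise extensions, cut off to that finite set, form an element of the direct sum. -/
theorem injective_directSum [IsNoetherianRing R] {ι : Type u} (E : ι → Type u)
    [∀ i, AddCommGroup (E i)] [∀ i, Module R (E i)] (hE : ∀ i, Module.Injective R (E i)) :
    Module.Injective R (DirectSum ι E) := by
  classical
  refine Module.Baer.injective fun I g => ?_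
  obtain ⟨S, hS⟩ := (isNoetherianRing_iff_ideal_fg R).mp inferInstance I
  have hext : ∀ i, ∃ e : E i, ∀ (a : R) (ha : a ∈ I), a • e = g ⟨a, ha⟩ i := fun i => by
    obtain ⟨h, hh⟩ := exists_extension (hE i) I.subtype I.injective_subtype
      (DirectSum.component R ι E i ∘ₗ g)
    refine ⟨h 1, fun a ha => ?_⟩
    rw [← map_smul, smul_eq_mul, mul_one]
    exact LinearMap.congr_fun hh ⟨a, ha⟩
  choose e he using hext
  let T : Finset ι := S.attach.biUnion fun a =>
    (g ⟨a, hS ▸ Ideal.subset_span a.2⟩).support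
  have hT : ∀ (a : R) (ha : a ∈ I) (i : ι), i ∉ T → g ⟨a, ha⟩ i = 0 := by
    intro a ha i hi
    have h1 : I ≤ Submodule.map I.subtype
        (LinearMap.ker (DirectSum.component R ι E i ∘ₗ g)) := by
      conv_lhs => rw [← hS]
      refine Submodule.span_le.mpr fun b hb => ?_
      -- Vanishing of the `i`-th component is a linear condition on the ideal, so it suffices to
      -- check it on the generators.
      refine ⟨⟨b, hS ▸ Ideal.subset_span hb⟩, ?_, rfl⟩
      have h2 : i ∉ (g ⟨b, hS ▸ Ideal.subset_span hb⟩).support := fun h3 =>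
        hi (Finset.mem_biUnion.mpr ⟨⟨b, hb⟩, Finset.mem_attach _ _, h3⟩)
      exact DFinsupp.notMem_support_iff.mp h2
    obtain ⟨b, hb, hba⟩ := h1 ha
    obtain rfl : b = ⟨a, ha⟩ := Subtype.ext hba
    exact hb
  refine ⟨LinearMap.toSpanSingleton R _ (DFinsupp.mk T fun i => e i), fun a ha => ?_⟩
  refine DFinsupp.ext fun i => ?_
  change (a • (DFinsupp.mk T fun i => e i) : DirectSum ι E) i = _
  rw [DirectSum.smul_apply]
  change a • (DFinsupp.mk T fun i => e i) i = _
  rw [DFinsupp.mk_apply]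
  split_ifs with h
  · exact he i a ha
  · rw [smul_zero, hT a ha i h]

theorem injectiveEnvelopeMap_one_ne_zero (𝔪 : Ideal R) (h𝔪 : 𝔪 ≠ ⊤) :
    injectiveEnvelopeMap R (R ⧸ 𝔪) 1 ≠ 0 := by
  have := Ideal.Quotient.nontrivial_iff.mpr h𝔪
  intro h
  exact one_ne_zero ((isInjectiveEnvelope_injectiveEnvelopeMap (R := R) (R ⧸ 𝔪)).injective
    (h.trans (map_zero _).symm))

theorem isInjectiveCogenerator_maxEnvelope [IsNoetherianRing R] :
    IsInjectiveCogenerator R (maxEnvelope R) := by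
  classical
  refine .of_isMaximal (injective_directSum _ fun 𝔪 =>
    (isInjectiveEnvelope_injectiveEnvelopeMap (R := R) (R ⧸ 𝔪.asIdeal)).injective_module)
    fun 𝔪 h𝔪 => ?_
  let j : MaximalSpectrum R := ⟨𝔪, h𝔪⟩
  refine ⟨DirectSum.lof R (MaximalSpectrum R)
    (fun 𝔪 => injectiveEnvelope R (R ⧸ 𝔪.asIdeal)) j ∘ₗ injectiveEnvelopeMap R (R ⧸ 𝔪),
    fun h => ?_⟩
  exact injectiveEnvelopeMap_one_ne_zero 𝔪 h𝔪.ne_top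
    (DirectSum.of_injective (β := fun 𝔪 : MaximalSpectrum R =>
      injectiveEnvelope R (R ⧸ 𝔪.asIdeal)) j (h.trans (map_zero _).symm))

theorem isInjectiveCogenerator_residueField (A : Type u) [CommRing A] [IsLocalRing A] :
    IsInjectiveCogenerator A (injectiveEnvelope A (IsLocalRing.ResidueField A)) := by
  refine .of_isMaximal (isInjectiveEnvelope_injectiveEnvelopeMap (R := A)
    (IsLocalRing.ResidueField A)).injective_module fun 𝔪 h𝔪 => ?_
  obtain rfl := IsLocalRing.eq_maximalIdeal h𝔪
  exact ⟨injectiveEnvelopeMap A (A ⧸ IsLocalRing.maximalIdeal A),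
    injectiveEnvelopeMap_one_ne_zero _ h𝔪.ne_top⟩

namespace IsInjectiveCogenerator

variable {E : Type u} [AddCommGroup E] [Module R E] (hE : IsInjectiveCogenerator R E)
include hE

theorem subsingleton_dual_iff (N : Type u) [AddCommGroup N] [Module R N] :
    Subsingleton (N →ₗ[R] E) ↔ Subsingleton N := by
  refine ⟨fun h => ⟨fun x y => ?_⟩, fun h => inferInstance⟩
  by_contra hxy
  obtain ⟨f, hf⟩ := hE.exists_apply_ne_zero N (x - y) (sub_ne_zero.mpr hxy)
  exact hf (by rw [Subsingleton.elim f 0]; rfl)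

end IsInjectiveCogenerator

end Cogenerator

/-! ### Socles of double duals -/

section Socle

variable {A : Type u} [CommRing A] [IsLocalRing A]

theorem subsingleton_residueField_hom_iff (N : Type u) [AddCommGroup N] [Module A N] :
    Subsingleton (IsLocalRing.ResidueField A →ₗ[A] N) ↔
      ∀ x : N, (∀ a ∈ IsLocalRing.maximalIdeal A, a • x = 0) → x = 0 := by
  constructor
  · intro h x hx
    let f : (A ⧸ IsLocalRing.maximalIdeal A) →ₗ[A] N :=
      Submodule.liftQ _ (LinearMap.toSpanSingleton A N x) (fun a ha => by simpa using hx a ha)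
    have h0 : f = 0 := @Subsingleton.elim _ h f 0
    exact ((Submodule.liftQ_apply _ _ _).trans (one_smul A x)).symm.trans
      (LinearMap.congr_fun h0 (Submodule.Quotient.mk 1))
  · intro h
    suffices ∀ f : IsLocalRing.ResidueField A →ₗ[A] N, f = 0 from
      ⟨fun f g => (this f).trans (this g).symm⟩
    intro f
    refine LinearMap.ext fun y => h _ fun a ha => ?_
    rw [← map_smul, Algebra.smul_def]
    have : algebraMap A (IsLocalRing.ResidueField A) a = 0 :=
      (IsLocalRing.residue_eq_zero_iff a).mpr ha
    rw [this, zero_mul, map_zero]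

/-- A socle element of `N` survives as an evaluation functional. Conversely, if `N` has no socle and
`𝔪 = (a₁, …, aᵣ)`, then `x ↦ (aᵢx)` embeds `N` in `Nʳ`; injectivity of `E` writes each `f : N → E`
as `∑ aᵢgᵢ`, and a functional killed by `𝔪` therefore vanishes on `f`. -/
theorem subsingleton_residueField_hom_dual_dual_iff [IsNoetherianRing A] {E : Type u}
    [AddCommGroup E] [Module A E] (hE : IsInjectiveCogenerator A E) (N : Type u) [AddCommGroup N]
    [Module A N] :
    Subsingleton (IsLocalRing.ResidueField A →ₗ[A] ((N →ₗ[A] E) →ₗ[A] E)) ↔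
      Subsingleton (IsLocalRing.ResidueField A →ₗ[A] N) := by
  rw [subsingleton_residueField_hom_iff, subsingleton_residueField_hom_iff]
  constructor
  · intro h x hx
    by_contra hne
    obtain ⟨f, hf⟩ := hE.exists_apply_ne_zero N x hne
    have h0 := h (LinearMap.applyₗ x) fun a ha => LinearMap.ext fun g => by
      change a • g x = 0
      rw [← map_smul, hx a ha, map_zero]
    exact hf (LinearMap.congr_fun h0 f)
  · intro h φ hφ
    obtain ⟨S, hS⟩ := (isNoetherianRing_iff_ideal_fg A).mp inferInstance
      (IsLocalRing.maximalIdeal A)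
    let i : N →ₗ[A] (S → N) := LinearMap.pi fun a => LinearMap.lsmul A N a
    have hi : Function.Injective i := by
      refine (injective_iff_map_eq_zero i).mpr fun x hx => h x fun a ha => ?_
      have h1 : IsLocalRing.maximalIdeal A ≤ LinearMap.ker (LinearMap.toSpanSingleton A N x) := by
        rw [← hS]
        exact Submodule.span_le.mpr fun b hb => congrFun hx ⟨b, hb⟩
      simpa using h1 ha
    refine LinearMap.ext fun f => ?_
    obtain ⟨g, rfl⟩ := exists_extension hE.injective i hi f
    classical
    have h2 : g ∘ₗ i = ∑ a : S, (a : A) • (g ∘ₗ LinearMap.single A (fun _ => N) a) := by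
      refine LinearMap.ext fun x => ?_
      have h3 : i x = ∑ a : S, (a : A) • Pi.single (M := fun _ => N) a x := by
        ext b
        simp [i, Finset.sum_apply, Pi.single_apply]
      simp [h3]
    rw [h2, map_sum]
    refine Finset.sum_eq_zero fun a _ => ?_
    rw [map_smul]
    exact LinearMap.congr_fun (hφ a (hS ▸ Ideal.subset_span a.2)) _

end Socle

/-! ### Homology of `Hom(M, E)` for injective `E` -/

section HomInto

variable {R : Type u} [CommRing R]

theorem exists_comp_eq_of_ker_le {E : Type u} [AddCommGroup E] [Module R E]
    (hE : Module.Injective R E) {N L : Type u} [AddCommGroup N] [Module R N] [AddCommGroup L]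
    [Module R L] (g : N →ₗ[R] L) (φ : N →ₗ[R] E) (h : LinearMap.ker g ≤ LinearMap.ker φ) :
    ∃ ψ : L →ₗ[R] E, ψ ∘ₗ g = φ := by
  obtain ⟨ψ, hψ⟩ := exists_extension hE ((LinearMap.ker g).liftQ g le_rfl)
    (LinearMap.ker_eq_bot.mp (Submodule.ker_liftQ_eq_bot _ _ _ le_rfl))
    ((LinearMap.ker g).liftQ φ h)
  refine ⟨ψ, LinearMap.ext fun x => ?_⟩
  have := LinearMap.congr_fun hψ (Submodule.Quotient.mk x)
  rwa [LinearMap.comp_apply, Submodule.liftQ_apply, Submodule.liftQ_apply] at this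

theorem nonempty_homology_linearEquiv (T : ShortComplex (ModuleCat.{u} R)) {V : Type u}
    [AddCommGroup V] [Module R V] (π : LinearMap.ker T.g.hom →ₗ[R] V)
    (hπ : Function.Surjective π) (hker : ∀ z, π z = 0 ↔ ∃ y, T.f.hom y = z.1) :
    Nonempty (T.homology ≃ₗ[R] V) := by
  refine ⟨T.moduleCatHomologyIso.toLinearEquiv.trans
    ((Submodule.quotEquivOfEq _ _ ?_).trans (π.quotKerEquivOfSurjective hπ))⟩
  ext z
  rw [LinearMap.mem_ker, hker]
  exact ⟨fun ⟨y, hy⟩ => ⟨y, congrArg Subtype.val hy⟩, fun ⟨y, hy⟩ => ⟨y, Subtype.ext hy⟩⟩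

/-- The linear form on the homology of a short complex induced by a linear form on its middle
term that vanishes on boundaries. -/
noncomputable def homologyDesc (S : ShortComplex (ModuleCat.{u} R)) (E : ModuleCat.{u} R) :
    LinearMap.ker (LinearMap.lcomp R E S.f.hom) →ₗ[R] (S.homology →ₗ[R] E) where
  toFun φ := (S.homologyι ≫ S.descOpcycles (ModuleCat.ofHom φ.1)
    (ModuleCat.hom_ext φ.2)).hom
  map_add' φ ψ := by
    rw [← ModuleCat.hom_add, ← Preadditive.comp_add]
    congr 2
    rw [← cancel_epi S.pOpcycles]
    simp
  map_smul' r φ := by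
    rw [RingHom.id_apply, ← ModuleCat.hom_smul, ← Linear.comp_smul]
    congr 2
    rw [← cancel_epi S.pOpcycles, Linear.comp_smul, S.p_descOpcycles, S.p_descOpcycles]
    rfl

/-- Homology embeds in the opcycles, so a form on it extends there by injectivity of `E`; composing
with the projection from the middle term gives a cocycle. -/
theorem homologyDesc_surjective (S : ShortComplex (ModuleCat.{u} R)) {E : ModuleCat.{u} R}
    (hE : Module.Injective R E) : Function.Surjective (homologyDesc S E) := by
  intro h
  obtain ⟨g, hg⟩ : ∃ g : S.opcycles ⟶ E, S.homologyι ≫ g = ModuleCat.ofHom h := by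
    obtain ⟨ψ, hψ⟩ := exists_extension hE S.homologyι.hom
      ((ModuleCat.mono_iff_injective _).mp inferInstance) h
    exact ⟨ModuleCat.ofHom ψ, ModuleCat.hom_ext hψ⟩
  have hfg : S.f ≫ S.pOpcycles ≫ g = 0 := by simp
  refine ⟨⟨(S.pOpcycles ≫ g).hom, congrArg ModuleCat.Hom.hom hfg⟩, ?_⟩
  change (S.homologyι ≫ S.descOpcycles (S.pOpcycles ≫ g) hfg).hom = (ModuleCat.ofHom h).hom
  rw [← hg]
  congr 2
  rw [← cancel_epi S.pOpcycles, S.p_descOpcycles]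

/-- Homology is the kernel of `S.fromOpcycles`, so a form on opcycles vanishing on it vanishes on
the kernel of `S.g`; by injectivity of `E` it then factors through `S.g`. -/
theorem homologyDesc_eq_zero_iff (S : ShortComplex (ModuleCat.{u} R)) {E : ModuleCat.{u} R}
    (hE : Module.Injective R E) (φ : LinearMap.ker (LinearMap.lcomp R E S.f.hom)) :
    homologyDesc S E φ = 0 ↔ ∃ ψ : S.X₃ →ₗ[R] E, ψ ∘ₗ S.g.hom = φ.1 := by
  constructor
  · intro h
    refine exists_comp_eq_of_ker_le hE _ _ fun x hx => ?_
    have h1 : S.fromOpcycles.hom (S.pOpcycles.hom x) = 0 := by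
      rw [← ModuleCat.comp_apply, S.p_fromOpcycles]
      exact hx
    obtain ⟨y, hy⟩ := (ShortComplex.moduleCat_exact_iff _).mp
      (ShortComplex.exact_of_f_is_kernel (.mk S.homologyι S.fromOpcycles (by simp))
        S.homologyIsKernel) _ h1
    have h2 : φ.1 x = (S.descOpcycles (ModuleCat.ofHom φ.1) (ModuleCat.hom_ext φ.2)).hom
        (S.pOpcycles.hom x) := by
      rw [← ModuleCat.comp_apply, S.p_descOpcycles]
      rfl
    rw [LinearMap.mem_ker, h2, ← hy]
    exact LinearMap.congr_fun h y
  · rintro ⟨ψ, hψ⟩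
    have h1 : S.descOpcycles (ModuleCat.ofHom φ.1) (ModuleCat.hom_ext φ.2) =
        S.fromOpcycles ≫ ModuleCat.ofHom ψ := by
      rw [← cancel_epi S.pOpcycles]
      simp [← hψ]
    change (S.homologyι ≫ S.descOpcycles (ModuleCat.ofHom φ.1) (ModuleCat.hom_ext φ.2)).hom = 0
    rw [h1]
    simp

theorem nonempty_homology_homInto_linearEquiv (M : CochainComplex (ModuleCat.{u} R) ℤ)
    {E : ModuleCat.{u} R} (hE : Module.Injective R E) (n : ℤ) :
    Nonempty ((homInto M E).homology n ≃ₗ[R] (M.homology (-n) →ₗ[R] E)) := by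
  let S := M.sc' (-(n + 1)) (-n) (-(n - 1))
  let T := (homInto M E).sc' (n - 1) n (n + 1)
  let eS : M.homology (-n) ≅ S.homology :=
    M.homologyIsoSc' (-(n + 1)) (-n) (-(n - 1)) (by rw [CochainComplex.prev]; lia)
      (by rw [CochainComplex.next]; lia)
  let eT : (homInto M E).homology n ≅ T.homology :=
    (homInto M E).homologyIsoSc' (n - 1) n (n + 1) (by simp) (by simp)
  -- The sign in the differential of `homInto` is a unit, so it changes neither kernels nor images.
  have hTg (φ : M.X (-n) →ₗ[R] E) : φ ∈ LinearMap.ker T.g.hom ↔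
      φ ∈ LinearMap.ker (LinearMap.lcomp R E S.f.hom) :=
    smul_eq_zero_iff_eq (n + 1).negOnePow (x := φ ∘ₗ S.f.hom)
  let eK : LinearMap.ker T.g.hom ≃ₗ[R] LinearMap.ker (LinearMap.lcomp R E S.f.hom) :=
    LinearEquiv.ofEq (LinearMap.ker T.g.hom) (LinearMap.ker (LinearMap.lcomp R E S.f.hom))
      (Submodule.ext hTg)
  obtain ⟨e⟩ := nonempty_homology_linearEquiv T (homologyDesc S E ∘ₗ eK.toLinearMap)
    ((homologyDesc_surjective S hE).comp eK.surjective) (fun z => by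
      refine (homologyDesc_eq_zero_iff S hE (eK z)).trans ?_
      have key (ψ : S.X₃ →ₗ[R] E) : T.f.hom ψ = (n - 1 + 1).negOnePow • (ψ ∘ₗ S.g.hom) := rfl
      constructor
      · rintro ⟨ψ, hψ⟩
        refine ⟨((n - 1 + 1).negOnePow⁻¹ • ψ : S.X₃ →ₗ[R] E), (key _).trans ?_⟩
        rw [LinearMap.smul_comp, smul_inv_smul]
        exact hψ
      · rintro ⟨ψ, hψ⟩
        refine ⟨(n - 1 + 1).negOnePow • (show S.X₃ →ₗ[R] E from ψ), ?_⟩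
        rw [LinearMap.smul_comp]
        exact (key _).symm.trans hψ)
  exact ⟨eT.toLinearEquiv.trans (e.trans (LinearEquiv.congrLeft E R eS.symm.toLinearEquiv))⟩

theorem isZero_homology_homInto_iff (M : CochainComplex (ModuleCat.{u} R) ℤ)
    {E : ModuleCat.{u} R} (hE : IsInjectiveCogenerator R E) (n : ℤ) :
    Limits.IsZero ((homInto M E).homology n) ↔ Limits.IsZero (M.homology (-n)) := by
  obtain ⟨e⟩ := nonempty_homology_homInto_linearEquiv M hE.injective n
  rw [ModuleCat.isZero_iff_subsingleton, ModuleCat.isZero_iff_subsingleton,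
    ← hE.subsingleton_dual_iff (M.homology (-n))]
  exact e.toEquiv.subsingleton_congr

end HomInto

/-! ### Localization of homology and of socle elements -/

section Localization

variable {R : Type u} [CommRing R]

/-- Localization commutes with the homology of complexes. -/
noncomputable def homologyLocalizationAtIso (𝔭 : PrimeSpectrum R)
    (M : CochainComplex (ModuleCat.{u} R) ℤ) (n : ℤ) :
    (localizationAt 𝔭 M).homology n ≅ (M.homology n).localizedModule 𝔭.asIdeal.primeCompl :=
  (M.sc n).mapHomologyIso (ModuleCat.localizedModuleFunctor 𝔭.asIdeal.primeCompl)

theorem isZero_homology_localizationAt (𝔭 : PrimeSpectrum R)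
    (M : CochainComplex (ModuleCat.{u} R) ℤ) (n : ℤ) (h : Limits.IsZero (M.homology n)) :
    Limits.IsZero ((localizationAt 𝔭 M).homology n) :=
  ((ModuleCat.localizedModuleFunctor 𝔭.asIdeal.primeCompl).map_isZero h).of_iso
    (homologyLocalizationAtIso 𝔭 M n)

/-- The image of `x` is killed by the maximal ideal, and it is nonzero because no element outside
`𝔭` annihilates `x`. -/
theorem not_subsingleton_residueField_hom_localizedModule (N : ModuleCat.{u} R)
    (𝔭 : PrimeSpectrum R) (x : N) (hx : ∀ r, r ∈ 𝔭.asIdeal ↔ r • x = 0) :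
    ¬ Subsingleton (𝔭.asIdeal.ResidueField →ₗ[Localization.AtPrime 𝔭.asIdeal]
      N.localizedModule 𝔭.asIdeal.primeCompl) := by
  rw [subsingleton_residueField_hom_iff]
  intro h
  have h0 := h (N.localizedModuleMkLinearMap 𝔭.asIdeal.primeCompl x) fun a ha => by
    obtain ⟨b, s, rfl⟩ := IsLocalization.exists_mk'_eq 𝔭.asIdeal.primeCompl a
    have hb : b ∈ 𝔭.asIdeal :=
      (IsLocalization.AtPrime.mk'_mem_maximal_iff _ 𝔭.asIdeal b s).mp ha
    rw [IsLocalization.mk'_eq_mul_mk'_one, mul_comm, mul_smul, algebraMap_smul, ← map_smul,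
      (hx b).mp hb, map_zero, smul_zero]
  obtain ⟨s, hs⟩ := (IsLocalizedModule.eq_zero_iff 𝔭.asIdeal.primeCompl
    (N.localizedModuleMkLinearMap 𝔭.asIdeal.primeCompl)).mp h0
  exact s.2 ((hx s).mpr hs)

end Localization

universe w v

/-! ### Maps out of a single object in the derived category -/

section DerivedHom

open DerivedCategory Limits

variable {C : Type u} [Category.{v} C] [Abelian C] [HasDerivedCategory.{w} C]

/-- A map from an object in degree 0 factors uniquely through `τ≤0 Y`, which for `Y` in degrees `≥
0` is `H⁰(Y)` placed in degree 0; the single functor is fully faithful. -/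
theorem subsingleton_singleFunctor_hom_iff (N : C) (Y : DerivedCategory C) [Y.IsGE 0] :
    Subsingleton ((singleFunctor C 0).obj N ⟶ Y) ↔
      Subsingleton (N ⟶ (homologyFunctor C 0).obj Y) := by
  let t := TStructure.t (C := C)
  let Y' := (t.truncLE 0).obj Y
  let m : Y' ⟶ Y := (t.truncLEι 0).app Y
  -- In the truncation triangle the third vertex has no cohomology in degrees `-1` and `0`.
  have : IsIso ((homologyFunctor C 0).map m) := by
    let T := (t.triangleLEGT 0).obj Y
    have hT : T ∈ distTriang _ := t.triangleLEGT_distinguished 0 Y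
    have : T.obj₃.IsGE 1 := inferInstanceAs (t.IsGE ((t.truncGT 0).obj Y) (0 + 1))
    have h1 : Mono ((homologyFunctor C 0).map m) :=
      (HomologySequence.mono_homologyMap_mor₁_iff T hT (-1) 0 (by lia)).mpr
        ((T.obj₃.isZero_of_isGE 1 (-1) (by lia)).eq_of_src _ _)
    have h2 : Epi ((homologyFunctor C 0).map m) :=
      (HomologySequence.epi_homologyMap_mor₁_iff T hT 0).mpr
        ((T.obj₃.isZero_of_isGE 1 0 (by lia)).eq_of_tgt _ _)
    exact isIso_of_mono_of_epi _
  have : Y'.IsGE 0 := inferInstanceAs (t.IsGE ((t.truncLE 0).obj Y) 0)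
  have : Y'.IsLE 0 := inferInstanceAs (t.IsLE ((t.truncLE 0).obj Y) 0)
  obtain ⟨Z, ⟨e⟩⟩ := exists_iso_singleFunctor_obj_of_isGE_of_isLE Y' 0
  have eZ : Z ≅ (homologyFunctor C 0).obj Y :=
    ((singleFunctorCompHomologyFunctorIso C 0).app Z).symm ≪≫
      (homologyFunctor C 0).mapIso e.symm ≪≫ asIso ((homologyFunctor C 0).map m)
  have hbij : Function.Bijective (fun f : (singleFunctor C 0).obj N ⟶ Y' => f ≫ m) :=
    ⟨fun f g h => t.to_truncLE_obj_ext h, fun f => ⟨t.liftTruncLE f 0, t.liftTruncLE_ι f 0⟩⟩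
  rw [← (Equiv.ofBijective _ hbij).subsingleton_congr, e.homToEquiv.subsingleton_congr,
    ← (Functor.FullyFaithful.ofFullyFaithful (singleFunctor C 0)).homEquiv.subsingleton_congr,
    eZ.homToEquiv.subsingleton_congr]

/-- Cohomology of the Hom complex is homotopy classes of maps, and these agree with derived maps
because `P` is K-projective. -/
theorem isZero_homology_homComplex_iff_subsingleton_derived {N : C} (P : ProjectiveResolution N)
    (L : CochainComplex C ℤ) (n : ℤ) :
    IsZero ((CochainComplex.HomComplex P.cochainComplex L).homology n) ↔
      Subsingleton ((singleFunctor C 0).obj N ⟶ Q.obj (L⟦n⟧)) := by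
  let e := quotientCompQhIso C
  let eN : Q.obj P.cochainComplex ≅ (singleFunctor C 0).obj N :=
    asIso (Q.map P.π') ≪≫ ((singleFunctorIsoCompQ C 0).app N).symm
  let e₁ := (CochainComplex.HomComplex.homologyAddEquiv P.cochainComplex L n).toEquiv
  let e₂ := (CochainComplex.HomComplex.CohomologyClass.homAddEquiv
    (K := P.cochainComplex) (L := L) (n := n)).toEquiv
  let e₃ := Equiv.ofBijective _ (CochainComplex.IsKProjective.Qh_map_bijective P.cochainComplex
    ((HomotopyCategory.quotient C (.up ℤ)).obj (L⟦n⟧)))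
  let e₄ := Iso.homCongr (e.app P.cochainComplex) (e.app (L⟦n⟧))
  exact AddCommGrpCat.isZero_iff_subsingleton.trans
    ((((e₁.trans e₂).trans e₃).trans e₄).trans eN.homFromEquiv).subsingleton_congr

end DerivedHom

/-! ### Lowest cohomology of `RHom(N, L)` -/

section HomComplex

open DerivedCategory Limits

variable {C : Type u} [Category.{v} C] [Abelian C]

theorem isGE_shift_of_isZero_homology (L : CochainComplex C ℤ) (a n b : ℤ) (hab : n + b ≤ a)
    (hL : ∀ i < a, IsZero (L.homology i)) : (L⟦n⟧).IsGE b := by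
  rw [CochainComplex.isGE_iff]
  intro i hi
  rw [HomologicalComplex.exactAt_iff_isZero_homology]
  exact (hL (n + i) (by lia)).of_iso
    (((HomologicalComplex.homologyFunctor C (.up ℤ) 0).shiftIso n i (n + i) rfl).app L)

attribute [local instance] HasDerivedCategory.standard

theorem isZero_homology_homComplex_of_lt {N : C} (P : ProjectiveResolution N)
    (L : CochainComplex C ℤ) (a : ℤ) (hL : ∀ i < a, IsZero (L.homology i)) (n : ℤ) (hn : n < a) :
    IsZero ((CochainComplex.HomComplex P.cochainComplex L).homology n) := by
  rw [isZero_homology_homComplex_iff_subsingleton_derived]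
  have := isGE_shift_of_isZero_homology L a n 1 (by lia) hL
  exact ⟨fun f g => (TStructure.t.zero_of_isLE_of_isGE f 0 1 (by lia) inferInstance
    inferInstance).trans (TStructure.t.zero_of_isLE_of_isGE g 0 1 (by lia) inferInstance
    inferInstance).symm⟩

theorem isZero_homology_homComplex_iff {N : C} (P : ProjectiveResolution N)
    (L : CochainComplex C ℤ) (a : ℤ) (hL : ∀ i < a, IsZero (L.homology i)) :
    IsZero ((CochainComplex.HomComplex P.cochainComplex L).homology a) ↔
      Subsingleton (N ⟶ L.homology a) := by
  rw [isZero_homology_homComplex_iff_subsingleton_derived]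
  have := isGE_shift_of_isZero_homology L a a 0 (by lia) hL
  rw [subsingleton_singleFunctor_hom_iff]
  exact (((homologyFunctorFactors C 0).app (L⟦a⟧)).trans
    (((HomologicalComplex.homologyFunctor C (.up ℤ) 0).shiftIso a 0 a
      (add_zero a)).app L)).homToEquiv.subsingleton_congr

end HomComplex

/-! ### A sign-free criterion for exactness of `Hom(M, E)` -/

section HomInto

variable {R : Type u} [CommRing R]

theorem isZero_homology_homInto_iff_forall (M : CochainComplex (ModuleCat.{u} R) ℤ)
    (E : ModuleCat.{u} R) (n : ℤ) :
    Limits.IsZero ((homInto M E).homology n) ↔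
      ∀ φ : M.X (-n) ⟶ E, M.d (-(n + 1)) (-n) ≫ φ = 0 →
        ∃ ψ : M.X (-(n - 1)) ⟶ E, M.d (-n) (-(n - 1)) ≫ ψ = φ := by
  have hd (k l : ℤ) (φ : M.X (-k) ⟶ E) : ((homInto M E).d k l).hom φ.hom =
      ((k + 1).negOnePow • (M.d (-l) (-k) ≫ φ)).hom := rfl
  rw [← HomologicalComplex.exactAt_iff_isZero_homology,
    HomologicalComplex.exactAt_iff' _ (n - 1) n (n + 1) (by simp) (by simp),
    ShortComplex.moduleCat_exact_iff]
  constructor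
  · intro h φ hφ
    obtain ⟨ψ, hψ⟩ := h φ.hom ((hd n (n + 1) φ).trans (by rw [hφ, smul_zero]; rfl))
    refine ⟨(n - 1 + 1).negOnePow • ModuleCat.ofHom ψ, ModuleCat.hom_ext ?_⟩
    rw [Linear.comp_units_smul]
    exact (hd (n - 1) n (ModuleCat.ofHom ψ)).symm.trans hψ
  · intro h φ hφ
    obtain ⟨ψ, hψ⟩ := h (ModuleCat.ofHom φ) ((smul_eq_zero_iff_eq (n + 1).negOnePow).mp
      (ModuleCat.hom_ext ((hd n (n + 1) (ModuleCat.ofHom φ)).symm.trans hφ)))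
    refine ⟨((n - 1 + 1).negOnePow⁻¹ • ψ).hom, (hd (n - 1) n _).trans ?_⟩
    rw [Linear.comp_units_smul, smul_inv_smul, hψ]
    rfl

end HomInto

/-! ### Tensor-hom adjunction for complexes -/

section TensorHom

open HomologicalComplex CochainComplex.HomComplex TensorProduct
open MonoidalCategory hiding tensorObj

variable {A : Type u} [CommRing A] (P Y : CochainComplex (ModuleCat.{u} A) ℤ) (E : ModuleCat.{u} A)

theorem ι_tensorObj_d_tmul (p i i' j j' : ℤ) (h : p + i = j) (hi : i + 1 = i') (hj : j + 1 = j') (x : P.X p)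
    (y : Y.X i) :
    ((tensorObj P Y).d j j').hom ((ιTensorObj P Y p i j h).hom (x ⊗ₜ y)) =
      (ιTensorObj P Y (p + 1) i j' (by lia)).hom ((P.d p (p + 1)).hom x ⊗ₜ y) +
      p.negOnePow • (ιTensorObj P Y p i' j' (by lia)).hom (x ⊗ₜ (Y.d i i').hom y) := by
  have h1 : ιTensorObj P Y p i j h ≫ (tensorObj P Y).d j j' =
      (P.d p (p + 1) ▷ Y.X i) ≫ ιTensorObj P Y (p + 1) i j' (by lia) +
      p.negOnePow • ((P.X p ◁ Y.d i i') ≫ ιTensorObj P Y p i' j' (by lia)) := by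
    rw [mapBifunctor.d_eq, Preadditive.comp_add, mapBifunctor.ι_D₁, mapBifunctor.ι_D₂,
      mapBifunctor.d₁_eq P Y (curriedTensor _) (.up ℤ) (show (ComplexShape.up ℤ).Rel p (p + 1)
        from rfl) i j' (show p + 1 + i = j' by lia),
      mapBifunctor.d₂_eq P Y (curriedTensor _) (.up ℤ) p (show (ComplexShape.up ℤ).Rel i i'
        from hi) j' (show p + i' = j' by lia)]
    simp
  exact LinearMap.congr_fun (congrArg ModuleCat.Hom.hom h1) (x ⊗ₜ y)

/-- The cochain from `P` to `Hom(Y, E)` attached to a linear form on `P ⊗ Y`. -/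
noncomputable def tensorHomCochain (j n : ℤ) (h : j + n = 0) (φ : (tensorObj P Y).X j ⟶ E) :
    Cochain P (homInto Y E) n :=
  Cochain.mk fun p q hpq => ModuleCat.ofHom
    (TensorProduct.curry (ιTensorObj P Y p (-q) j (by lia) ≫ φ).hom)

theorem tensorHomCochain_injective (j n : ℤ) (h : j + n = 0) :
    Function.Injective (tensorHomCochain P Y E j n h) := by
  intro φ ψ hφψ
  refine mapBifunctor.hom_ext (F := curriedTensor (ModuleCat.{u} A)) (K₁ := P) (K₂ := Y)
    fun p i hi => ?_
  have hi' : p + i = j := hi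
  obtain ⟨q, rfl⟩ : ∃ q, i = -q := ⟨-i, by lia⟩
  refine ModuleCat.hom_ext (TensorProduct.ext' fun x y => ?_)
  have h1 := Cochain.congr_v hφψ p q (by lia)
  exact LinearMap.congr_fun (show (_ : Y.X (-q) →ₗ[A] E) = _ from
    LinearMap.congr_fun (congrArg ModuleCat.Hom.hom h1) x) y

theorem tensorHomCochain_surjective (j n : ℤ) (h : j + n = 0) :
    Function.Surjective (tensorHomCochain P Y E j n h) := by
  intro z
  let g (p q : ℤ) (hpq : p + n = q) : P.X p ⊗ Y.X (-q) ⟶ E :=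
    ModuleCat.ofHom (TensorProduct.lift (z.v p q hpq).hom)
  -- The summand index `i` equals `-(-i)` only propositionally, so the components must be
  -- transported along that equality.
  have hg (p q q' : ℤ) (hpq : p + n = q) (hpq' : p + n = q') :
      (P.X p ◁ (Y.XIsoOfEq (show -q = -q' by lia)).hom) ≫ g p q' hpq' = g p q hpq := by
    obtain rfl : q = q' := by lia
    simp
  let f (p i : ℤ) (hi : ComplexShape.π (.up ℤ) (.up ℤ) (.up ℤ) (p, i) = j) :
      ((curriedTensor (ModuleCat.{u} A)).obj (P.X p)).obj (Y.X i) ⟶ E :=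
    (P.X p ◁ (Y.XIsoOfEq (show i = - -i by lia)).hom) ≫
      g p (-i) (by have : p + i = j := hi; lia)
  let φ : (tensorObj P Y).X j ⟶ E := mapBifunctorDesc f
  refine ⟨φ, Cochain.ext _ _ fun p q hpq => ?_⟩
  have h1 : ιTensorObj P Y p (-q) j (by lia) ≫ φ = g p q hpq :=
    (ι_mapBifunctorDesc f p (-q) (show p + -q = j by lia)).trans (hg p q (- -q) hpq (by lia))
  change ModuleCat.ofHom (TensorProduct.curry (ιTensorObj P Y p (-q) j _ ≫ φ).hom) = _
  rw [h1]
  rfl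

theorem tensorHomCochain_units_smul (j n : ℤ) (h : j + n = 0) (ε : ℤˣ)
    (φ : (tensorObj P Y).X j ⟶ E) :
    tensorHomCochain P Y E j n h (ε • φ) = ε • tensorHomCochain P Y E j n h φ := by
  refine Cochain.ext _ _ fun p q hpq => ModuleCat.hom_ext (LinearMap.ext fun x => ?_)
  exact LinearMap.ext (fun (y : Y.X (-q)) => rfl : ∀ y : Y.X (-q),
    (_ : Y.X (-q) →ₗ[A] E) y = (_ : Y.X (-q) →ₗ[A] E) y)

/-- The adjunction respects differentials only up to the sign `(-1)^m`: in bidegree `p + m = q` the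
dual differential contributes `(-1)^q = (-1)^m (-1)^p`, and `(-1)^p` is the Koszul sign of the
tensor differential. -/
theorem δ_tensorHomCochain (j n j' m : ℤ) (h : j + n = 0) (hm : n + 1 = m) (hj : j' + 1 = j)
    (φ : (tensorObj P Y).X j ⟶ E) :
    δ n m (tensorHomCochain P Y E j n h φ) =
      m.negOnePow • tensorHomCochain P Y E j' m (by lia) ((tensorObj P Y).d j' j ≫ φ) := by
  refine Cochain.ext _ _ fun p q hpq => ModuleCat.hom_ext (LinearMap.ext fun x => ?_)
  refine LinearMap.ext (fun (y : Y.X (-q)) => ?_ : ∀ y : Y.X (-q),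
    (_ : Y.X (-q) →ₗ[A] E) y = (_ : Y.X (-q) →ₗ[A] E) y)
  rw [δ_v n m hm _ p q hpq (q - 1) (p + 1) rfl rfl]
  have hL1 : (q - 1 + 1).negOnePow • φ.hom ((ιTensorObj P Y p (-(q - 1)) j (by lia)).hom
      (x ⊗ₜ[A] (Y.d (-q) (-(q - 1))).hom y)) + m.negOnePow • φ.hom
      ((ιTensorObj P Y (p + 1) (-q) j (by lia)).hom ((P.d p (p + 1)).hom x ⊗ₜ[A] y)) =
      m.negOnePow • φ.hom (((tensorObj P Y).d j' j).hom
        ((ιTensorObj P Y p (-q) j' (by lia)).hom (x ⊗ₜ[A] y))) := by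
    rw [ι_tensorObj_d_tmul P Y p (-q) (-(q - 1)) j' j (by lia) (by lia) hj, map_add, smul_add,
      add_comm, show q - 1 + 1 = p + m by lia, Int.negOnePow_add, mul_comm, mul_smul]
    congr 2
    exact (map_zsmul_unit φ.hom _ _).symm
  exact hL1

/-- The bijections commute with differentials up to units, so cocycles and coboundaries correspond;
this holds on the chain level for every module `E`. -/
theorem isZero_homology_homInto_tensorObj_iff (n : ℤ) :
    Limits.IsZero ((homInto (tensorObj P Y) E).homology n) ↔
      Limits.IsZero ((CochainComplex.HomComplex P (homInto Y E)).homology n) := by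
  let Φ (k : ℤ) := tensorHomCochain P Y E (-k) k (neg_add_cancel k)
  have hΦ (k l : ℤ) (h : k + 1 = l) (φ : (tensorObj P Y).X (-k) ⟶ E) :
      δ k l (Φ k φ) = l.negOnePow • Φ l ((tensorObj P Y).d (-l) (-k) ≫ φ) :=
    δ_tensorHomCochain P Y E (-k) k (-l) l _ h (by lia) φ
  have hb (k : ℤ) : Function.Bijective (Φ k) :=
    ⟨tensorHomCochain_injective P Y E _ _ _, tensorHomCochain_surjective P Y E _ _ _⟩
  rw [isZero_homology_homInto_iff_forall, ← exactAt_iff_isZero_homology,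
    exactAt_iff' _ (n - 1) n (n + 1) (by simp) (by simp), ShortComplex.ab_exact_iff]
  let T := tensorObj P Y
  have key : (∀ φ : T.X (-n) ⟶ E, T.d (-(n + 1)) (-n) ≫ φ = 0 →
      ∃ ψ : T.X (-(n - 1)) ⟶ E, T.d (-n) (-(n - 1)) ≫ ψ = φ) ↔
      ∀ z : Cochain P (homInto Y E) n, δ n (n + 1) z = 0 →
        ∃ y : Cochain P (homInto Y E) (n - 1), δ (n - 1) n y = z := by
    rw [(hb n).surjective.forall]
    refine forall_congr' fun φ => imp_congr ?_ ?_
    · rw [hΦ n (n + 1) rfl, smul_eq_zero_iff_eq]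
      exact ⟨fun h => by rw [h]; rfl, fun h => (hb (n + 1)).injective (h.trans rfl)⟩
    · rw [(hb (n - 1)).surjective.exists]
      constructor
      · rintro ⟨ψ, rfl⟩
        refine ⟨n.negOnePow • ψ, ?_⟩
        rw [hΦ (n - 1) n (by lia), Linear.comp_units_smul]
        exact (congrArg _ (tensorHomCochain_units_smul P Y E _ _ _ _ _)).trans (by
          rw [smul_smul, Int.units_mul_self, one_smul])
      · rintro ⟨ψ, hψ⟩
        refine ⟨n.negOnePow • ψ, (hb n).injective ?_⟩
        rw [hΦ (n - 1) n (by lia)] at hψ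
        rw [← hψ, Linear.comp_units_smul]
        exact tensorHomCochain_units_smul P Y E _ _ _ _ _
  exact key

end TensorHom

/-! ### Suprema and infima of bounded complexes -/

section InfSup

open Limits

variable {C : Type*} [Category* C] [Abelian C] (M : CochainComplex C ℤ)

theorem hsup_le (s : ℤ) (h : ∀ n > s, IsZero (M.homology (-n))) : hsup M ≤ ((s : ℝ) : EReal) := by
  refine sSup_le ?_
  rintro _ ⟨n, hn, rfl⟩
  have : n ≤ s := not_lt.mp fun hs => hn (h n hs)
  exact EReal.coe_le_coe_iff.mpr (Int.cast_le.mpr this)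

theorem le_hinf (i : ℤ) (h : ∀ n < i, IsZero (M.homology (-n))) : ((i : ℝ) : EReal) ≤ hinf M := by
  refine le_sInf ?_
  rintro _ ⟨n, hn, rfl⟩
  have : i ≤ n := not_lt.mp fun hs => hn (h n hs)
  exact EReal.coe_le_coe_iff.mpr (Int.cast_le.mpr this)

theorem hsup_eq_iff (s : ℤ) (h : ∀ n > s, IsZero (M.homology (-n))) :
    hsup M = ((s : ℝ) : EReal) ↔ ¬ IsZero (M.homology (-s)) := by
  refine ⟨fun hs h0 => ?_, fun hs => le_antisymm (hsup_le M s h) (le_sSup ⟨s, hs, rfl⟩)⟩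
  have h1 := hsup_le M (s - 1) fun n hn => by
    obtain rfl | hn' := eq_or_ne n s
    · exact h0
    · exact h n (by lia)
  rw [hs] at h1
  have : s ≤ s - 1 := by exact_mod_cast h1
  lia

theorem hinf_eq_iff (i : ℤ) (h : ∀ n < i, IsZero (M.homology (-n))) :
    hinf M = ((i : ℝ) : EReal) ↔ ¬ IsZero (M.homology (-i)) := by
  refine ⟨fun hs h0 => ?_, fun hs => le_antisymm (sInf_le ⟨i, hs, rfl⟩) (le_hinf M i h)⟩
  have h1 := le_hinf M (i + 1) fun n hn => by
    obtain rfl | hn' := eq_or_ne n i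
    · exact h0
    · exact h n (by lia)
  rw [hs] at h1
  have : i + 1 ≤ i := by exact_mod_cast h1
  lia

theorem hsup_eq_bot_of_acyclic (hM : M.Acyclic) : hsup M = ⊥ := by
  have : {n : ℤ | ¬ IsZero (M.homology (-n))} = ∅ :=
    Set.eq_empty_of_forall_notMem fun n hn => hn (hM (-n)).isZero_homology
  rw [hsup, this, Set.image_empty, sSup_empty]

theorem acyclic_iff_isZero_homology : M.Acyclic ↔ ∀ n, IsZero (M.homology n) :=
  forall_congr' fun _ => HomologicalComplex.exactAt_iff_isZero_homology _ _

theorem exists_top_homology_of_not_acyclic (hM : ¬ M.Acyclic) (b : ℤ)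
    (hb : ∀ n > b, IsZero (M.homology (-n))) :
    ∃ s : ℤ, ¬ IsZero (M.homology (-s)) ∧ ∀ n > s, IsZero (M.homology (-n)) := by
  rw [acyclic_iff_isZero_homology, not_forall] at hM
  obtain ⟨m, hm⟩ := hM
  obtain ⟨s, hs, hmax⟩ := Int.exists_greatest_of_bdd
    (P := fun n => ¬ IsZero (M.homology (-n)))
    ⟨b, fun n hn => not_lt.mp fun h => hn (hb n h)⟩ ⟨-m, by rwa [neg_neg]⟩
  exact ⟨s, hs, fun n hn => by_contra fun h => absurd (hmax n h) (by lia)⟩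

end InfSup

/-! ### Depth and width via socles -/

section LocalRing

open Limits

variable {A : Type u} [CommRing A] [IsLocalRing A] (X : CochainComplex (ModuleCat.{u} A) ℤ)

theorem depth_eq_iff (s : ℤ) (h : ∀ n > s, IsZero (X.homology (-n))) :
    depth X = -((s : ℝ) : EReal) ↔
      ¬ Subsingleton (IsLocalRing.ResidueField A →ₗ[A] X.homology (-s)) := by
  have hX : ∀ i < -s, IsZero (X.homology i) := fun i hi => by
    simpa using h (-i) (by lia)
  rw [depth, neg_inj, hsup_eq_iff, RHomResidueField, residueFieldResolution,
    isZero_homology_homComplex_iff _ X (-s) hX, ModuleCat.homEquiv.subsingleton_congr]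
  · exact fun n hn => isZero_homology_homComplex_of_lt _ X (-s) hX _ (by lia)

/-- Dualizing into the cogenerator turns vanishing of `H_n(k ⊗ᴸ X)` into vanishing of cohomology of
`RHom(k, Hom(X, E))`, whose lowest possibly nonzero degree is `i`. -/
theorem width_eq_iff {E : ModuleCat.{u} A} (hE : IsInjectiveCogenerator A E) (i : ℤ)
    (h : ∀ n < i, IsZero (X.homology (-n))) :
    width X = ((i : ℝ) : EReal) ↔
      ¬ Subsingleton (IsLocalRing.ResidueField A →ₗ[A] (homInto X E).homology i) := by
  have hX : ∀ n < i, IsZero ((homInto X E).homology n) := fun n hn =>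
    (isZero_homology_homInto_iff X hE n).mpr (h n hn)
  have hT (n : ℤ) : IsZero ((residueFieldTensorL X).homology (-n)) ↔
      IsZero ((CochainComplex.HomComplex (residueFieldResolution A) (homInto X E)).homology n) :=
    (isZero_homology_homInto_iff _ hE n).symm.trans
      (isZero_homology_homInto_tensorObj_iff (residueFieldResolution A) X E n)
  rw [width, hinf_eq_iff, hT, residueFieldResolution, isZero_homology_homComplex_iff _ _ i hX,
    ModuleCat.homEquiv.subsingleton_congr]
  · exact fun n hn => (hT n).mpr (isZero_homology_homComplex_of_lt _ _ i hX n hn)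

theorem subsingleton_residueField_hom_homology_homInto_homInto_iff [IsNoetherianRing A]
    {E : ModuleCat.{u} A} (hE : IsInjectiveCogenerator A E) (i : ℤ) :
    Subsingleton (IsLocalRing.ResidueField A →ₗ[A] (homInto (homInto X E) E).homology i) ↔
      Subsingleton (IsLocalRing.ResidueField A →ₗ[A] X.homology i) := by
  obtain ⟨e₁⟩ := nonempty_homology_homInto_linearEquiv (homInto X E) hE.injective i
  obtain ⟨e₂⟩ : Nonempty ((homInto X E).homology (-i) ≃ₗ[A] (X.homology i →ₗ[A] E)) := by
    have := nonempty_homology_homInto_linearEquiv X hE.injective (-i)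
    rwa [neg_neg] at this
  rw [← subsingleton_residueField_hom_dual_dual_iff hE (X.homology i)]
  exact (LinearEquiv.congrRight (e₁.trans
    (LinearEquiv.congrLeft E A e₂))).toEquiv.subsingleton_congr

theorem depth_eq_neg_hsup_and_lt_top_iff (s : ℤ) (hs : ¬ IsZero (X.homology (-s)))
    (h : ∀ n > s, IsZero (X.homology (-n))) :
    (depth X = -hsup X ∧ -hsup X < ⊤) ↔
      ¬ Subsingleton (IsLocalRing.ResidueField A →ₗ[A] X.homology (-s)) := by
  rw [(hsup_eq_iff X s h).mpr hs, depth_eq_iff X s h, and_iff_left]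
  exact EReal.coe_lt_top (-(s : ℝ))

/-- The local form of the theorem: with `s = sup X`, both sides say that `k` maps nontrivially to a
module, `H_s(X)` for depth and its double dual for width. -/
theorem width_eq_hinf_homInto_iff_depth_eq_neg_hsup [IsNoetherianRing A] {E : ModuleCat.{u} A}
    (hE : IsInjectiveCogenerator A E) (b : ℤ) (hb : ∀ n > b, IsZero (X.homology (-n))) :
    (¬ (homInto X E).Acyclic ∧ width (homInto X E) = hinf (homInto X E) ∧
      ⊥ < hinf (homInto X E)) ↔ (depth X = -hsup X ∧ -hsup X < ⊤) := by
  have hY (n : ℤ) : IsZero ((homInto X E).homology (-n)) ↔ IsZero (X.homology n) := by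
    have := isZero_homology_homInto_iff X hE (-n)
    rwa [neg_neg] at this
  have hac : (homInto X E).Acyclic ↔ X.Acyclic := by
    rw [acyclic_iff_isZero_homology, acyclic_iff_isZero_homology]
    exact (Equiv.neg ℤ).forall_congr_left.trans (forall_congr' hY)
  by_cases hX : X.Acyclic
  -- Both sides fail: the left excludes acyclicity, and on the right `-hsup X = -⊥ = ⊤`.
  · rw [hac, hsup_eq_bot_of_acyclic X hX]
    simp [hX]
  obtain ⟨s, hs, hmax⟩ := exists_top_homology_of_not_acyclic X hX b hb
  have hmin : ∀ n < -s, IsZero ((homInto X E).homology (-n)) := fun n hn =>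
    (hY n).mpr (by simpa using hmax (-n) (by lia))
  rw [depth_eq_neg_hsup_and_lt_top_iff X s hs hmax, hac,
    (hinf_eq_iff _ (-s) hmin).mpr fun h => hs ((hY _).mp h),
    width_eq_iff (homInto X E) hE (-s) hmin,
    subsingleton_residueField_hom_homology_homInto_homInto_iff X hE, and_iff_right hX,
    and_iff_left]
  exact EReal.bot_lt_coe _

end LocalRing

/-! ### The Matlis dual and existence of associated primes -/

section MatlisDual

open Limits

theorem acyclic_localizationAt {R : Type u} [CommRing R] (𝔭 : PrimeSpectrum R)
    (M : CochainComplex (ModuleCat.{u} R) ℤ) (hM : M.Acyclic) :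
    (localizationAt 𝔭 M).Acyclic := by
  rw [acyclic_iff_isZero_homology] at hM ⊢
  exact fun n => isZero_homology_localizationAt 𝔭 M n (hM n)

variable {R : Type u} [CommRing R] [IsNoetherianRing R] (M : CochainComplex (ModuleCat.{u} R) ℤ)

theorem isZero_homology_matlisDual_iff (n : ℤ) :
    IsZero ((matlisDual M).homology n) ↔ IsZero (M.homology (-n)) :=
  isZero_homology_homInto_iff M isInjectiveCogenerator_maxEnvelope n

theorem acyclic_matlisDual_iff : (matlisDual M).Acyclic ↔ M.Acyclic := by
  rw [acyclic_iff_isZero_homology, acyclic_iff_isZero_homology]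
  exact (forall_congr' (isZero_homology_matlisDual_iff M)).trans
    ((Equiv.neg ℤ).forall_congr_right (q := fun n => IsZero (M.homology n)))

/-- An associated prime of the top homology module works: localizing there keeps a nonzero socle
element in that degree, so the supremum does not drop. -/
theorem exists_mem_Ass_of_not_acyclic (hM : ¬ M.Acyclic) (b : ℤ)
    (hb : ∀ n > b, IsZero (M.homology (-n))) : (Ass M).Nonempty := by
  obtain ⟨s, hs, hmax⟩ := exists_top_homology_of_not_acyclic M hM b hb
  rw [ModuleCat.isZero_iff_subsingleton, not_subsingleton_iff_nontrivial] at hs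
  obtain ⟨p, hp⟩ := associatedPrimes.nonempty R (M.homology (-s))
  obtain ⟨hprime, x, hx⟩ := isAssociatedPrime_iff.mp hp
  let 𝔭 : PrimeSpectrum R := ⟨p, hprime⟩
  have hsub := not_subsingleton_residueField_hom_localizedModule (M.homology (-s)) 𝔭 x
    (fun r => by
      change r ∈ p ↔ _
      rw [hx, Submodule.mem_colon_singleton, Submodule.mem_bot])
  have hsub' : ¬ Subsingleton (𝔭.asIdeal.ResidueField →ₗ[Localization.AtPrime 𝔭.asIdeal]
      (localizationAt 𝔭 M).homology (-s)) := fun h => hsub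
    ((LinearEquiv.congrRight
      (homologyLocalizationAtIso 𝔭 M (-s)).toLinearEquiv).toEquiv.subsingleton_congr.mp h)
  refine ⟨𝔭, (depth_eq_neg_hsup_and_lt_top_iff (localizationAt 𝔭 M) s (fun h => hsub' ?_)
    fun n hn => isZero_homology_localizationAt 𝔭 M _ (hmax n hn)).mpr hsub'⟩
  rw [ModuleCat.isZero_iff_subsingleton] at h
  infer_instance

end MatlisDual

end CoassPrimes

theorem theorem6p2 {R : Type u} [CommRing R] [IsNoetherianRing R]
    (M : CochainComplex (ModuleCat.{u} R) ℤ) (hM : CoassPrimes.IsBoundedBelow M) :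
    (∀ 𝔭 : PrimeSpectrum R,
      𝔭 ∈ CoassPrimes.Coass M ↔ 𝔭 ∈ CoassPrimes.Ass (CoassPrimes.matlisDual M)) ∧
    (¬ M.Acyclic ↔ (CoassPrimes.Coass M).Nonempty) := by
  obtain ⟨N, hN⟩ := hM
  -- Duality reverses degrees: the lower bound `N` for `M` becomes the upper bound `-N` for
  -- `D_R(M)`.
  have hb : ∀ n > -N, Limits.IsZero ((CoassPrimes.matlisDual M).homology (-n)) := fun n hn =>
    (CoassPrimes.isZero_homology_matlisDual_iff M (-n)).mpr (hN (-n) (by lia))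
  have hiff : ∀ 𝔭 : PrimeSpectrum R,
      𝔭 ∈ CoassPrimes.Coass M ↔ 𝔭 ∈ CoassPrimes.Ass (CoassPrimes.matlisDual M) := fun 𝔭 =>
    CoassPrimes.width_eq_hinf_homInto_iff_depth_eq_neg_hsup
      (CoassPrimes.localizationAt 𝔭 (CoassPrimes.matlisDual M))
      (CoassPrimes.isInjectiveCogenerator_residueField _) (-N)
      fun n hn => CoassPrimes.isZero_homology_localizationAt 𝔭 _ _ (hb n hn)
  refine ⟨hiff, fun hM => ?_, ?_⟩
  · obtain ⟨𝔭, h𝔭⟩ := CoassPrimes.exists_mem_Ass_of_not_acyclic _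
      (mt (CoassPrimes.acyclic_matlisDual_iff M).mp hM) (-N) hb
    exact ⟨𝔭, (hiff 𝔭).mpr h𝔭⟩
  · rintro ⟨𝔭, h𝔭⟩ hM
    -- Finiteness in `Ass` excludes acyclic localizations, where `-hsup = ⊤`.
    have h1 := ((hiff 𝔭).mp h𝔭).2
    rw [CoassPrimes.hsup_eq_bot_of_acyclic _ (CoassPrimes.acyclic_localizationAt 𝔭 _
      ((CoassPrimes.acyclic_matlisDual_iff M).mpr hM))] at h1
    exact lt_irrefl _ h1
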